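/- **Languages.** Fix a first-order signature of function symbols (constants included) and predicate letters. *Ordinary terms* are built from variables and function symbols. Formulas are taken up to renaming of bound variables, and $A^x_t$ is the (capture-free) result of putting $t$ for the free $x$ in $A$. Both languages have atomic formulas $P t_1\ldots t_n$, $t_1=t_2$ and $\exists!t$ ("$t$ exists"), and $\bot,\land,\lor,\rightarrow,\forall,\exists$; $\neg A$ is $A\rightarrow\bot$, and $A\leftrightarrow B$ is $(A\rightarrow B)\land(B\rightarrow A)$. The language of $\mathbf{INF}^\iota$ has only ordinary terms, and in addition the formulas $\iota x[F,G]$ ("the $F$ is $G$"), where $\iota$ binds $x$ in $F$ and $G$. The language of $\mathbf{INF}^{LL\Delta}$ has in addition the terms $\iota xA$ ("the $A$") and the formulas $\Delta xB,t$ (the predicate abstract of $B$ applied to $t$); in it the $\iota$ terms may stand left or right of $=$, as $t$ in $\Delta xB,t$, and as $t$ in $\exists!t$, but not as arguments of predicate letters or function symbols. **Intuitionist negative free logic $\mathbf{INF}$** is the natural deduction system with the usual intuitionist introduction and elimination rules for $\land,\lor,\rightarrow$, and with: - $\bot E$: from $\bot$ infer any atomic formula. - $\forall I$: infer $\forall xA$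 from a deduction of $A^x_y$ that may discharge $\exists!y$. $\forall E$: from $\forall xA$ and $\exists!t$ infer $A^x_t$. - $\exists I$: from $A^x_t$ and $\exists!t$ infer $\exists xA$. $\exists E$: from $\exists xA$ and a deduction of $C$ that may discharge $A^x_y$ and $\exists!y$, infer $C$. - ${=}I$: from $\exists!t$ infer $t=t$. ${=}E$: from $t_1=t_2$ and $A^x_{t_1}$, with $A$ atomic, infer $A^x_{t_2}$. - $AD$: from $Pt_1\ldots t_n$ infer $\exists!t_i$, and from $t_1=t_2$ infer $\exists!t_1$ and $\exists!t_2$. Here and below, the variable $y$ (or $z$) of a subdeduction with discharged assumptions must be fresh: not free in the formula inferred, in the other formulas of the rule, or in any undischarged assumption of that subdeduction. **$\mathbf{INF}^\iota$** is $\mathbf{INF}$ in its language with the rules: - $\iota I$: from $F^x_t$, $G^x_t$, $\exists!t$ and a deduction of $z=t$ that may discharge $F^x_z$ and $\exists!z$, infer $\iota x[F,G]$. - $\iota E^1$: from $\iota x[F,G]$ and a deduction of $C$ that may discharge $F^x_z$, $G^x_z$ and $\exists!z$, infer $C$. - $\iota E^2$: from $\iota x[F,G]$, $\exists!t_1$,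 $\exists!t_2$, $F^x_{t_1}$ and $F^x_{t_2}$ infer $t_1=t_2$. **$\mathbf{INF}^{LL\Delta}$** is $\mathbf{INF}$ in its language (the terms in the rules of $\mathbf{INF}$ may be $\iota$ terms, as long as the results of substitution are formulas of the language) with all instances of the following axioms: - $LL$: $\forall y(\iota xF=y\leftrightarrow\forall x(F\leftrightarrow x=y))$; - $\Delta t$: $\Delta xB,t\leftrightarrow(\exists!t\land B^x_t)$, where $B^x_t$ is a formula of the language; - $\Delta\iota$: $\Delta xB,\iota xA\leftrightarrow\exists z(\iota xA=z\land B^x_z)$, with $z$ not free in $A$ or in $\Delta xB$. In each system $\Gamma\vdash A$ means that there is a deduction of $A$ all of whose undischarged assumptions belong to the (possibly infinite) set $\Gamma$. **Translations.** $\tau$, from the language of $\mathbf{INF}^{LL\Delta}$ to that of $\mathbf{INF}^\iota$, leaves atomic formulas without $\iota$ terms and $\bot$ unchanged, commutes with $\land,\lor,\rightarrow,\forall,\exists$, and, for an ordinary term $t$ in which $x$ is not free, has $\tau(\iota xA=t)=\iota x[\tau(A),x=t]$, $\tau(t=\iota xA)=\iota x[\tau(A),t=x]$, $\tau(\iota xA=\iota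 yB)=\iota x[\tau(A),\iota y[\tau(B),x=y]]$ (with $x\neq y$, $x$ not free in $B$), $\tau(\exists!\iota xA)=\iota x[\tau(A),\exists!x]$, $\tau(\Delta xB,t)=\iota x[t=x,\tau(B)]$ and $\tau(\Delta xB,\iota xA)=\iota x[\tau(A),\tau(B)]$. $\upsilon$, in the opposite direction, leaves atomic formulas and $\bot$ unchanged, commutes with $\land,\lor,\rightarrow,\forall,\exists$, and has $\upsilon(\iota x[A,B])=\Delta x\,\upsilon(B),\iota x\,\upsilon(A)$. For a set $\Gamma$ of formulas, $\tau(\Gamma)$ and $\upsilon(\Gamma)$ are the sets of the translations of its members. **Theorem 2.** $\mathbf{INF}^\iota$ and $\mathbf{INF}^{LL\Delta}$ are equivalent: for all sets $\Gamma$ of formulas and all formulas $A$ of the respective language, (a) if $\Gamma\vdash A$ in $\mathbf{INF}^\iota$, then $\upsilon(\Gamma)\vdash\upsilon(A)$ in $\mathbf{INF}^{LL\Delta}$; (b) if $\Gamma\vdash A$ in $\mathbf{INF}^{LL\Delta}$, then $\tau(\Gamma)\vdash\tau(A)$ in $\mathbf{INF}^\iota$. -/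

import Mathlib

/-!
Syntax with de Bruijn indices: variables are natural numbers, every binder binds index `0` and
raises the other indices by one. Formulas are thus taken up to renaming of bound variables, and
`A.inst t` is `A` with `t` put for the variable bound by the outermost binder, without capture.
-/

universe u v

namespace FreeLogic


/-- A renaming of variables, carried under one binder. -/
def liftRen (ρ : ℕ → ℕ) : ℕ → ℕ
  | 0 => 0
  | n + 1 => ρ n + 1

section Quantifier

/-- Formulas of the language with the binary quantifier `iota F G`, "the `F` is `G`"; it binds one
variable in both `F` and `G`. The formula `exi t` says that `t` exists. -/
inductive IForm (L : FirstOrder.Language.{u, v}) : Type (max u v)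
  | falsum : IForm L
  | rel {n : ℕ} (R : L.Relations n) (ts : Fin n → L.Term ℕ) : IForm L
  | exi (t : L.Term ℕ) : IForm L
  | eq (s t : L.Term ℕ) : IForm L
  | and (A B : IForm L) : IForm L
  | or (A B : IForm L) : IForm L
  | imp (A B : IForm L) : IForm L
  | all (A : IForm L) : IForm L
  | ex (A : IForm L) : IForm L
  | iota (F G : IForm L) : IForm L

variable {L : FirstOrder.Language.{u, v}}

/-- A term moved under one binder. -/
def tshift (t : L.Term ℕ) : L.Term ℕ := t.relabel Nat.succ

/-- A substitution of terms for variables, carried under one binder. -/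
def liftSub (σ : ℕ → L.Term ℕ) : ℕ → L.Term ℕ
  | 0 => FirstOrder.Language.Term.var 0
  | n + 1 => tshift (σ n)

/-- The substitution that puts `t` for the variable of the removed binder. -/
def single (t : L.Term ℕ) : ℕ → L.Term ℕ
  | 0 => t
  | n + 1 => FirstOrder.Language.Term.var n

namespace IForm

/-- Renaming of free variables. -/
def rename : (ℕ → ℕ) → IForm L → IForm L
  | _, falsum => falsum
  | ρ, rel R ts => rel R fun i => (ts i).relabel ρ
  | ρ, exi t => exi (t.relabel ρ)
  | ρ, eq s t => eq (s.relabel ρ) (t.relabel ρ)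
  | ρ, and A B => and (rename ρ A) (rename ρ B)
  | ρ, or A B => or (rename ρ A) (rename ρ B)
  | ρ, imp A B => imp (rename ρ A) (rename ρ B)
  | ρ, all A => all (rename (liftRen ρ) A)
  | ρ, ex A => ex (rename (liftRen ρ) A)
  | ρ, iota F G => iota (rename (liftRen ρ) F) (rename (liftRen ρ) G)

/-- A formula moved under one binder (whose variable is then not free in it). -/
def shift (A : IForm L) : IForm L := A.rename Nat.succ

/-- Simultaneous substitution of terms for the free variables. -/
def subst : (ℕ → L.Term ℕ) → IForm L → IForm L
  | _, falsum => falsum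
  | σ, rel R ts => rel R fun i => (ts i).subst σ
  | σ, exi t => exi (t.subst σ)
  | σ, eq s t => eq (s.subst σ) (t.subst σ)
  | σ, and A B => and (subst σ A) (subst σ B)
  | σ, or A B => or (subst σ A) (subst σ B)
  | σ, imp A B => imp (subst σ A) (subst σ B)
  | σ, all A => all (subst (liftSub σ) A)
  | σ, ex A => ex (subst (liftSub σ) A)
  | σ, iota F G => iota (subst (liftSub σ) F) (subst (liftSub σ) G)

/-- `A.inst t` is `A` with `t` for `x`, where `x` is the variable with index `0` in `A`. -/
def inst (A : IForm L) (t : L.Term ℕ) : IForm L := A.subst (single t)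

/-- Atomic formulas: predicate letters, identity and the existence predicate. -/
def IsAtomic : IForm L → Prop
  | rel _ _ => True
  | exi _ => True
  | eq _ _ => True
  | _ => False

/-- Negation, by its intuitionist definition. -/
def neg (A : IForm L) : IForm L := imp A falsum

/-- The biconditional. -/
def iff (A B : IForm L) : IForm L := and (imp A B) (imp B A)

end IForm

open IForm in
/-- `IProv Γ A`: there is a natural deduction of `A` from undischarged assumptions in `Γ` in
intuitionist negative free logic with the binary quantifier. A discharged assumption is one that is
inserted into `Γ` in a premise. The eigenvariable of a rule is the variable `0`, which is fresh
because the assumptions and the side formulas are shifted. -/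
inductive IProv : Set (IForm L) → IForm L → Prop
  | ax {Γ : Set (IForm L)} {A : IForm L} : A ∈ Γ → IProv Γ A
  | andI {Γ : Set (IForm L)} {A B : IForm L} : IProv Γ A → IProv Γ B → IProv Γ (and A B)
  | andE1 {Γ : Set (IForm L)} {A B : IForm L} : IProv Γ (and A B) → IProv Γ A
  | andE2 {Γ : Set (IForm L)} {A B : IForm L} : IProv Γ (and A B) → IProv Γ B
  | impI {Γ : Set (IForm L)} {A B : IForm L} : IProv (insert A Γ) B → IProv Γ (imp A B)
  | impE {Γ : Set (IForm L)} {A B : IForm L} : IProv Γ (imp A B) → IProv Γ A → IProv Γ B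
  | orI1 {Γ : Set (IForm L)} {A B : IForm L} : IProv Γ A → IProv Γ (or A B)
  | orI2 {Γ : Set (IForm L)} {A B : IForm L} : IProv Γ B → IProv Γ (or A B)
  | orE {Γ : Set (IForm L)} {A B C : IForm L} :
      IProv Γ (or A B) → IProv (insert A Γ) C → IProv (insert B Γ) C → IProv Γ C
  | falsumE {Γ : Set (IForm L)} {A : IForm L} : A.IsAtomic → IProv Γ falsum → IProv Γ A
  | allI {Γ : Set (IForm L)} {A : IForm L} :
      IProv (insert (exi (FirstOrder.Language.Term.var 0)) (shift '' Γ)) A → IProv Γ (all A)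
  | allE {Γ : Set (IForm L)} {A : IForm L} (t : L.Term ℕ) :
      IProv Γ (all A) → IProv Γ (exi t) → IProv Γ (A.inst t)
  | exI {Γ : Set (IForm L)} {A : IForm L} (t : L.Term ℕ) :
      IProv Γ (A.inst t) → IProv Γ (exi t) → IProv Γ (ex A)
  | exE {Γ : Set (IForm L)} {A C : IForm L} :
      IProv Γ (ex A) →
      IProv (insert A (insert (exi (FirstOrder.Language.Term.var 0)) (shift '' Γ))) C.shift → IProv Γ C
  | eqI {Γ : Set (IForm L)} {t : L.Term ℕ} : IProv Γ (exi t) → IProv Γ (eq t t)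
  | eqE {Γ : Set (IForm L)} {A : IForm L} {s t : L.Term ℕ} : A.IsAtomic →
      IProv Γ (eq s t) → IProv Γ (A.inst s) → IProv Γ (A.inst t)
  | adRel {Γ : Set (IForm L)} {n : ℕ} {R : L.Relations n} {ts : Fin n → L.Term ℕ} (i : Fin n) :
      IProv Γ (rel R ts) → IProv Γ (exi (ts i))
  | adEq1 {Γ : Set (IForm L)} {s t : L.Term ℕ} : IProv Γ (eq s t) → IProv Γ (exi s)
  | adEq2 {Γ : Set (IForm L)} {s t : L.Term ℕ} : IProv Γ (eq s t) → IProv Γ (exi t)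
  | iotaI {Γ : Set (IForm L)} {F G : IForm L} (t : L.Term ℕ) :
      IProv Γ (F.inst t) → IProv Γ (G.inst t) → IProv Γ (exi t) →
      IProv (insert F (insert (exi (FirstOrder.Language.Term.var 0)) (shift '' Γ)))
        (eq (FirstOrder.Language.Term.var 0) (tshift t)) →
      IProv Γ (iota F G)
  | iotaE1 {Γ : Set (IForm L)} {F G C : IForm L} :
      IProv Γ (iota F G) →
      IProv (insert F (insert G (insert (exi (FirstOrder.Language.Term.var 0)) (shift '' Γ)))) C.shift →
      IProv Γ C
  | iotaE2 {Γ : Set (IForm L)} {F G : IForm L} {s t : L.Term ℕ} :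
      IProv Γ (iota F G) → IProv Γ (exi s) → IProv Γ (exi t) →
      IProv Γ (F.inst s) → IProv Γ (F.inst t) → IProv Γ (eq s t)

end Quantifier

section Abstraction

mutual

/-- Individual terms of the language with a term forming `ι`: the ordinary terms, and the `ι` terms
"the `A`", which bind one variable in `A`. -/
inductive DTerm (L : FirstOrder.Language.{u, v}) : Type (max u v)
  | ord (t : L.Term ℕ) : DTerm L
  | iota (A : DForm L) : DTerm L

/-- Formulas of the language with a term forming `ι` and predicate abstraction. Here
`delta B t` is the predicate abstract of `B` (binding one variable in `B`) applied to `t`.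
The `ι` terms stand as sides of an identity, as the subject of a predicate abstract, and as the
subject of the existence predicate, but not as arguments of predicate letters or function
symbols. -/
inductive DForm (L : FirstOrder.Language.{u, v}) : Type (max u v)
  | falsum : DForm L
  | rel {n : ℕ} (R : L.Relations n) (ts : Fin n → L.Term ℕ) : DForm L
  | exi (t : DTerm L) : DForm L
  | eq (s t : DTerm L) : DForm L
  | and (A B : DForm L) : DForm L
  | or (A B : DForm L) : DForm L
  | imp (A B : DForm L) : DForm L
  | all (A : DForm L) : DForm L
  | ex (A : DForm L) : DForm L
  | delta (B : DForm L) (t : DTerm L) : DForm L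

end

variable {L : FirstOrder.Language.{u, v}}

mutual

/-- Renaming of free variables in a term. -/
def DTerm.rename : (ℕ → ℕ) → DTerm L → DTerm L
  | ρ, .ord t => .ord (t.relabel ρ)
  | ρ, .iota A => .iota (DForm.rename (liftRen ρ) A)

/-- Renaming of free variables in a formula. -/
def DForm.rename : (ℕ → ℕ) → DForm L → DForm L
  | _, .falsum => .falsum
  | ρ, .rel R ts => .rel R fun i => (ts i).relabel ρ
  | ρ, .exi t => .exi (DTerm.rename ρ t)
  | ρ, .eq s t => .eq (DTerm.rename ρ s) (DTerm.rename ρ t)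
  | ρ, .and A B => .and (DForm.rename ρ A) (DForm.rename ρ B)
  | ρ, .or A B => .or (DForm.rename ρ A) (DForm.rename ρ B)
  | ρ, .imp A B => .imp (DForm.rename ρ A) (DForm.rename ρ B)
  | ρ, .all A => .all (DForm.rename (liftRen ρ) A)
  | ρ, .ex A => .ex (DForm.rename (liftRen ρ) A)
  | ρ, .delta B t => .delta (DForm.rename (liftRen ρ) B) (DTerm.rename ρ t)

end

/-- A term moved under one binder. -/
def DTerm.shift (t : DTerm L) : DTerm L := t.rename Nat.succ

/-- A formula moved under one binder. -/
def DForm.shift (A : DForm L) : DForm L := A.rename Nat.succ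

/-- The variable `n` as a term. -/
def DTerm.var (n : ℕ) : DTerm L := .ord (FirstOrder.Language.Term.var n)

/-- The ordinary term that `t` is. The value at an `ι` term is a dummy: it can enter a formula only
by substitution into an argument of a predicate letter or function symbol, which the condition
`DForm.Admits` on the rules excludes. -/
def DTerm.toTerm : DTerm L → L.Term ℕ
  | .ord t => t
  | .iota _ => FirstOrder.Language.Term.var 0

/-- A substitution of terms for variables, carried under one binder. -/
def liftDSub (σ : ℕ → DTerm L) : ℕ → DTerm L
  | 0 => DTerm.var 0
  | n + 1 => (σ n).shift

/-- The substitution that puts `t` for the variable of the removed binder. -/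
def dsingle (t : DTerm L) : ℕ → DTerm L
  | 0 => t
  | n + 1 => DTerm.var n

mutual

/-- Simultaneous substitution of terms for the free variables of a term. -/
def DTerm.subst : (ℕ → DTerm L) → DTerm L → DTerm L
  | σ, .ord (.var i) => σ i
  | σ, .ord (.func f ts) => .ord ((FirstOrder.Language.Term.func f ts).subst fun i => (σ i).toTerm)
  | σ, .iota A => .iota (DForm.subst (liftDSub σ) A)

/-- Simultaneous substitution of terms for the free variables of a formula. -/
def DForm.subst : (ℕ → DTerm L) → DForm L → DForm L
  | _, .falsum => .falsum
  | σ, .rel R ts => .rel R fun i => (ts i).subst fun i => (σ i).toTerm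
  | σ, .exi t => .exi (DTerm.subst σ t)
  | σ, .eq s t => .eq (DTerm.subst σ s) (DTerm.subst σ t)
  | σ, .and A B => .and (DForm.subst σ A) (DForm.subst σ B)
  | σ, .or A B => .or (DForm.subst σ A) (DForm.subst σ B)
  | σ, .imp A B => .imp (DForm.subst σ A) (DForm.subst σ B)
  | σ, .all A => .all (DForm.subst (liftDSub σ) A)
  | σ, .ex A => .ex (DForm.subst (liftDSub σ) A)
  | σ, .delta B t => .delta (DForm.subst (liftDSub σ) B) (DTerm.subst σ t)

end

mutual

/-- The variable `n` does not occur inside an argument of a function symbol or predicate letter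
in the term. -/
def DTerm.Iotable : ℕ → DTerm L → Prop
  | _, .ord (.var _) => True
  | n, .ord (.func f ts) => n ∉ (FirstOrder.Language.Term.func f ts).varFinset
  | n, .iota A => DForm.Iotable (n + 1) A

/-- The variable `n` does not occur inside an argument of a function symbol or predicate letter
in the formula, so that `ι` terms may be substituted for it. -/
def DForm.Iotable : ℕ → DForm L → Prop
  | _, .falsum => True
  | n, .rel _ ts => ∀ i, n ∉ (ts i).varFinset
  | n, .exi t => DTerm.Iotable n t
  | n, .eq s t => DTerm.Iotable n s ∧ DTerm.Iotable n t
  | n, .and A B => DForm.Iotable n A ∧ DForm.Iotable n B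
  | n, .or A B => DForm.Iotable n A ∧ DForm.Iotable n B
  | n, .imp A B => DForm.Iotable n A ∧ DForm.Iotable n B
  | n, .all A => DForm.Iotable (n + 1) A
  | n, .ex A => DForm.Iotable (n + 1) A
  | n, .delta B t => DForm.Iotable (n + 1) B ∧ DTerm.Iotable n t

end

namespace DForm

/-- `A.inst t` is `A` with `t` for `x`, where `x` is the variable with index `0` in `A`. -/
def inst (A : DForm L) (t : DTerm L) : DForm L := A.subst (dsingle t)

/-- The result of putting `t` for the variable `0` in `A` is a formula of the language: always if
`t` is an ordinary term, and if `t` is an `ι` term, when that variable stands in `A` only where `ι`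
terms may stand. -/
def Admits (A : DForm L) : DTerm L → Prop
  | .ord _ => True
  | .iota _ => A.Iotable 0

/-- Atomic formulas: predicate letters, identity and the existence predicate. -/
def IsAtomic : DForm L → Prop
  | rel _ _ => True
  | exi _ => True
  | eq _ _ => True
  | _ => False

/-- Negation, by its intuitionist definition. -/
def neg (A : DForm L) : DForm L := imp A falsum

/-- The biconditional. -/
def iff (A B : DForm L) : DForm L := and (imp A B) (imp B A)

/-- Lambert's Law `∀ y (ι x F = y ↔ ∀ x (F ↔ x = y))`; in `F`, index `0` is `x` and `1` is `y`. -/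
def lambert (F : DForm L) : DForm L :=
  all (iff (eq (.iota F) (.var 0)) (all (iff F (eq (.var 0) (.var 1)))))

/-- The abstraction principle `Δ x B, t ↔ (∃! t ∧ B(t))`. -/
def absTerm (B : DForm L) (t : DTerm L) : DForm L :=
  iff (delta B t) (and (exi t) (B.inst t))

/-- The abstraction principle `Δ x B, ι x A ↔ ∃ z (ι x A = z ∧ B(z))`. -/
def absIota (A B : DForm L) : DForm L :=
  iff (delta B (.iota A)) (ex (and (eq (DTerm.shift (.iota A)) (.var 0)) B))

end DForm

open DForm in
/-- `DProv Γ A`: there is a natural deduction of `A` from undischarged assumptions in `Γ` in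
intuitionist negative free logic, over the language with `ι` terms and predicate abstraction, with
Lambert's Law and the two abstraction principles as axioms. -/
inductive DProv : Set (DForm L) → DForm L → Prop
  | ax {Γ : Set (DForm L)} {A : DForm L} : A ∈ Γ → DProv Γ A
  | andI {Γ : Set (DForm L)} {A B : DForm L} : DProv Γ A → DProv Γ B → DProv Γ (and A B)
  | andE1 {Γ : Set (DForm L)} {A B : DForm L} : DProv Γ (and A B) → DProv Γ A
  | andE2 {Γ : Set (DForm L)} {A B : DForm L} : DProv Γ (and A B) → DProv Γ B
  | impI {Γ : Set (DForm L)} {A B : DForm L} : DProv (insert A Γ) B → DProv Γ (imp A B)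
  | impE {Γ : Set (DForm L)} {A B : DForm L} : DProv Γ (imp A B) → DProv Γ A → DProv Γ B
  | orI1 {Γ : Set (DForm L)} {A B : DForm L} : DProv Γ A → DProv Γ (or A B)
  | orI2 {Γ : Set (DForm L)} {A B : DForm L} : DProv Γ B → DProv Γ (or A B)
  | orE {Γ : Set (DForm L)} {A B C : DForm L} :
      DProv Γ (or A B) → DProv (insert A Γ) C → DProv (insert B Γ) C → DProv Γ C
  | falsumE {Γ : Set (DForm L)} {A : DForm L} : A.IsAtomic → DProv Γ falsum → DProv Γ A
  | allI {Γ : Set (DForm L)} {A : DForm L} :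
      DProv (insert (exi (.var 0)) (shift '' Γ)) A → DProv Γ (all A)
  | allE {Γ : Set (DForm L)} {A : DForm L} (t : DTerm L) : A.Admits t →
      DProv Γ (all A) → DProv Γ (exi t) → DProv Γ (A.inst t)
  | exI {Γ : Set (DForm L)} {A : DForm L} (t : DTerm L) : A.Admits t →
      DProv Γ (A.inst t) → DProv Γ (exi t) → DProv Γ (ex A)
  | exE {Γ : Set (DForm L)} {A C : DForm L} :
      DProv Γ (ex A) →
      DProv (insert A (insert (exi (.var 0)) (shift '' Γ))) C.shift → DProv Γ C
  | eqI {Γ : Set (DForm L)} {t : DTerm L} : DProv Γ (exi t) → DProv Γ (eq t t)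
  | eqE {Γ : Set (DForm L)} {A : DForm L} {s t : DTerm L} : A.IsAtomic →
      A.Admits s → A.Admits t →
      DProv Γ (eq s t) → DProv Γ (A.inst s) → DProv Γ (A.inst t)
  | adRel {Γ : Set (DForm L)} {n : ℕ} {R : L.Relations n} {ts : Fin n → L.Term ℕ} (i : Fin n) :
      DProv Γ (rel R ts) → DProv Γ (exi (.ord (ts i)))
  | adEq1 {Γ : Set (DForm L)} {s t : DTerm L} : DProv Γ (eq s t) → DProv Γ (exi s)
  | adEq2 {Γ : Set (DForm L)} {s t : DTerm L} : DProv Γ (eq s t) → DProv Γ (exi t)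
  | lambert {Γ : Set (DForm L)} (F : DForm L) : DProv Γ (DForm.lambert F)
  | absTerm {Γ : Set (DForm L)} (B : DForm L) (t : DTerm L) : B.Admits t →
      DProv Γ (DForm.absTerm B t)
  | absIota {Γ : Set (DForm L)} (A B : DForm L) : DProv Γ (DForm.absIota A B)

end Abstraction

section Translations

variable {L : FirstOrder.Language.{u, v}}

/-- The translation `τ` into the language with the binary quantifier: it is homophonic but for
`∃! ι x A ↦ ι x [A, ∃! x]`, `ι x A = t ↦ ι x [A, x = t]`, `t = ι x A ↦ ι x [A, t = x]`,
`ι x A = ι y B ↦ ι x [A, ι y [B, x = y]]`, `Δ x B, t ↦ ι x [t = x, B]`, and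
`Δ x B, ι x A ↦ ι x [A, B]`. -/
def tau : DForm L → IForm L
  | .falsum => .falsum
  | .rel R ts => .rel R ts
  | .exi (.ord t) => .exi t
  | .exi (.iota A) => .iota (tau A) (.exi (FirstOrder.Language.Term.var 0))
  | .eq (.ord s) (.ord t) => .eq s t
  | .eq (.iota A) (.ord t) => .iota (tau A) (.eq (FirstOrder.Language.Term.var 0) (tshift t))
  | .eq (.ord s) (.iota B) => .iota (tau B) (.eq (tshift s) (FirstOrder.Language.Term.var 0))
  | .eq (.iota A) (.iota B) =>
      .iota (tau A) (.iota ((tau B).rename (liftRen Nat.succ))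
        (.eq (FirstOrder.Language.Term.var 1) (FirstOrder.Language.Term.var 0)))
  | .and A B => .and (tau A) (tau B)
  | .or A B => .or (tau A) (tau B)
  | .imp A B => .imp (tau A) (tau B)
  | .all A => .all (tau A)
  | .ex A => .ex (tau A)
  | .delta B (.ord t) => .iota (.eq (tshift t) (FirstOrder.Language.Term.var 0)) (tau B)
  | .delta B (.iota A) => .iota (tau A) (tau B)

/-- The translation `υ` into the language with `ι` terms and predicate abstraction: it is
homophonic but for `ι x [A, B] ↦ Δ x B, ι x A`. -/
def upsilon : IForm L → DForm L
  | .falsum => .falsum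
  | .rel R ts => .rel R ts
  | .exi t => .exi (.ord t)
  | .eq s t => .eq (.ord s) (.ord t)
  | .and A B => .and (upsilon A) (upsilon B)
  | .or A B => .or (upsilon A) (upsilon B)
  | .imp A B => .imp (upsilon A) (upsilon B)
  | .all A => .all (upsilon A)
  | .ex A => .ex (upsilon A)
  | .iota A B => .delta (upsilon B) (.iota (upsilon A))

end Translations

end FreeLogic

/-!
For `τ`, write "`t` denotes `x`" for `τ(t = x)`: an identity if `t` is ordinary, and "the unique `F`
is `x`" if `t` is `ι x F`. Up to provable equivalence, every atomic formula in which `t` may be an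
`ι` term is then translated by `∃ x (t denotes x ∧ …)`. If `t` denotes `x`, the terms `t` and `x`
denote the same individual, and an induction on formulas shows that replacing one by the other does
not change the translation up to equivalence. So the quantifier and identity rules for `ι x F`
reduce to those for a variable which it denotes.

For `υ`, the formula `Δ x G, ι x F` unfolds to `∃ z (ι x F = z ∧ G(z))`, and Lambert's law turns
`ι x F = z` into "`z` is the only `F`", from which the rules for `ι x [F, G]` follow.
-/

namespace FreeLogic

open FirstOrder.Language (Term)

section Terms

variable {L : FirstOrder.Language.{u, v}}

theorem term_relabel_eq_subst (ρ : ℕ → ℕ) (t : L.Term ℕ) :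
    t.relabel ρ = t.subst fun i => .var (ρ i) := by
  induction t with
  | var i => rfl
  | func f ts ih => simp only [Term.relabel, Term.subst, ih]

theorem term_subst_subst (σ π : ℕ → L.Term ℕ) (t : L.Term ℕ) :
    (t.subst σ).subst π = t.subst fun i => (σ i).subst π := by
  induction t with
  | var i => rfl
  | func f ts ih => simp only [Term.subst, ih]

theorem term_subst_var (t : L.Term ℕ) : t.subst .var = t := by
  induction t with
  | var i => rfl
  | func f ts ih => simp only [Term.subst, ih]

theorem term_subst_congr {σ π : ℕ → L.Term ℕ} {t : L.Term ℕ}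
    (h : ∀ i ∈ t.varFinset, σ i = π i) : t.subst σ = t.subst π := by
  induction t with
  | var i => exact h i (by simp only [Term.varFinset, Finset.mem_singleton])
  | func f ts ih =>
    refine congrArg (Term.func f) (funext fun k => ih k fun i hi => h i ?_)
    simpa only [Term.varFinset, Finset.mem_biUnion, Finset.mem_univ, true_and] using ⟨k, hi⟩

theorem tshift_eq_subst (t : L.Term ℕ) : tshift t = t.subst fun i => .var (i + 1) :=
  term_relabel_eq_subst _ t

theorem tshift_subst_single (s t : L.Term ℕ) : (tshift t).subst (single s) = t := by
  rw [tshift_eq_subst, term_subst_subst]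
  exact term_subst_var t

theorem tshift_relabel_liftRen (ρ : ℕ → ℕ) (t : L.Term ℕ) :
    (tshift t).relabel (liftRen ρ) = tshift (t.relabel ρ) := by
  simp only [tshift_eq_subst, term_relabel_eq_subst, term_subst_subst]
  rfl

theorem tshift_subst_liftSub (σ : ℕ → L.Term ℕ) (t : L.Term ℕ) :
    (tshift t).subst (liftSub σ) = tshift (t.subst σ) := by
  simp only [tshift_eq_subst, term_subst_subst, Term.subst, liftSub]

theorem liftSub_var_comp (ρ : ℕ → ℕ) :
    liftSub (fun i => (.var (ρ i) : L.Term ℕ)) = fun i => .var (liftRen ρ i) := by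
  funext i
  cases i <;> rfl

theorem liftSub_var : liftSub (.var : ℕ → L.Term ℕ) = .var := by
  funext i
  cases i <;> rfl

theorem liftSub_subst_liftSub (σ π : ℕ → L.Term ℕ) (i : ℕ) :
    (liftSub σ i).subst (liftSub π) = liftSub (fun i => (σ i).subst π) i := by
  cases i with
  | zero => rfl
  | succ i => exact tshift_subst_liftSub π (σ i)

end Terms

namespace IForm

variable {L : FirstOrder.Language.{u, v}}

theorem rename_eq_subst (A : IForm L) (ρ : ℕ → ℕ) :
    A.rename ρ = A.subst fun i => .var (ρ i) := by
  induction A generalizing ρ <;>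
    simp_all only [rename, subst, term_relabel_eq_subst, liftSub_var_comp]

theorem subst_subst (A : IForm L) (σ π : ℕ → L.Term ℕ) :
    (A.subst σ).subst π = A.subst fun i => (σ i).subst π := by
  induction A generalizing σ π <;>
    simp_all only [subst, term_subst_subst, liftSub_subst_liftSub]

theorem subst_inst (A : IForm L) (σ : ℕ → L.Term ℕ) (t : L.Term ℕ) :
    (A.subst σ).inst t = A.subst fun i => (σ i).subst (single t) :=
  subst_subst A σ (single t)

theorem subst_var (A : IForm L) : A.subst .var = A := by
  induction A <;> simp_all only [subst, term_subst_var, liftSub_var]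

theorem rename_id (A : IForm L) : A.rename id = A :=
  (rename_eq_subst A id).trans (subst_var A)

theorem rename_rename (A : IForm L) (ρ π : ℕ → ℕ) :
    (A.rename ρ).rename π = A.rename fun i => π (ρ i) := by
  simp only [rename_eq_subst, subst_subst]
  rfl

theorem shift_rename_liftRen (A : IForm L) (ρ : ℕ → ℕ) :
    A.shift.rename (liftRen ρ) = (A.rename ρ).shift := by
  simp only [shift, rename_rename]
  rfl

theorem inst_rename (A : IForm L) (t : L.Term ℕ) (ρ : ℕ → ℕ) :
    (A.inst t).rename ρ = (A.rename (liftRen ρ)).inst (t.relabel ρ) := by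
  simp only [inst, rename_eq_subst, subst_subst]
  congr 1
  funext i
  cases i with
  | zero => exact (term_relabel_eq_subst ρ t).symm
  | succ i => rfl

theorem inst_shift (A : IForm L) (t : L.Term ℕ) :
    (A.inst t).shift = (A.rename (liftRen Nat.succ)).inst (tshift t) :=
  inst_rename A t Nat.succ

theorem rename_liftRen_succ_inst_zero (A : IForm L) :
    (A.rename (liftRen Nat.succ)).inst (.var 0) = A := by
  rw [rename_eq_subst, inst, subst_subst]
  convert subst_var A using 2
  funext i
  cases i <;> rfl

/-- The substitution that exchanges the variables of the two innermost binders; it turns a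
substitution for the outer one into an instance. -/
def swap : ℕ → L.Term ℕ
  | 0 => .var 1
  | 1 => .var 0
  | n + 2 => .var (n + 2)

theorem subst_subst_liftSub_single (A : IForm L) (κ : ℕ → L.Term ℕ) (t : L.Term ℕ) :
    (A.subst κ).subst (liftSub (single t)) =
      (A.subst fun i => (κ i).subst swap).inst (tshift t) := by
  rw [← subst_subst A κ swap, inst, subst_subst _ swap]
  congr 1
  funext i
  rcases i with _ | _ | i <;> rfl

theorem IsAtomic.rename {A : IForm L} (h : A.IsAtomic) (ρ : ℕ → ℕ) : (A.rename ρ).IsAtomic := by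
  cases A <;> exact h

theorem IsAtomic.subst {A : IForm L} (h : A.IsAtomic) (σ : ℕ → L.Term ℕ) :
    (A.subst σ).IsAtomic := by
  cases A <;> exact h

/-- The assumptions `Γ` carried under a binder, whose variable `0` may be assumed to exist: the
context of the subdeduction in a rule with an eigenvariable. -/
abbrev underBinder (Γ : Set (IForm L)) : Set (IForm L) :=
  insert (exi (.var 0)) (shift '' Γ)

end IForm

namespace IProv

open IForm

variable {L : FirstOrder.Language.{u, v}} {Γ Δ : Set (IForm L)} {A A' B B' C F F' G G' : IForm L}
  {s t u : L.Term ℕ}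

theorem rename {ρ : ℕ → ℕ} (h : IProv Γ A) (hΔ : ∀ B ∈ Γ, B.rename ρ ∈ Δ) :
    IProv Δ (A.rename ρ) := by
  have insert_mem : ∀ {Γ Δ : Set (IForm L)} {ρ : ℕ → ℕ} (A : IForm L),
      (∀ B ∈ Γ, B.rename ρ ∈ Δ) → ∀ B ∈ insert A Γ, B.rename ρ ∈ insert (A.rename ρ) Δ := by
    rintro Γ Δ ρ A h B (rfl | hB)
    · exact Set.mem_insert _ _
    · exact Set.mem_insert_of_mem _ (h B hB)
  have under_mem : ∀ {Γ Δ : Set (IForm L)} {ρ : ℕ → ℕ}, (∀ B ∈ Γ, B.rename ρ ∈ Δ) →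
      ∀ B ∈ underBinder Γ, B.rename (liftRen ρ) ∈ underBinder Δ := by
    intro Γ Δ ρ h
    refine insert_mem _ ?_
    rintro _ ⟨B, hB, rfl⟩
    exact ⟨_, h B hB, (shift_rename_liftRen B ρ).symm⟩
  induction h generalizing ρ Δ with
  | ax h => exact ax (hΔ _ h)
  | andI _ _ ih1 ih2 => exact andI (ih1 hΔ) (ih2 hΔ)
  | andE1 _ ih => exact andE1 (ih hΔ)
  | andE2 _ ih => exact andE2 (ih hΔ)
  | impI _ ih => exact impI (ih (insert_mem _ hΔ))
  | impE _ _ ih1 ih2 => exact impE (ih1 hΔ) (ih2 hΔ)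
  | orI1 _ ih => exact orI1 (ih hΔ)
  | orI2 _ ih => exact orI2 (ih hΔ)
  | orE _ _ _ ih ih1 ih2 => exact orE (ih hΔ) (ih1 (insert_mem _ hΔ)) (ih2 (insert_mem _ hΔ))
  | falsumE hA _ ih => exact falsumE (hA.rename ρ) (ih hΔ)
  | allI _ ih => exact allI (ih (under_mem hΔ))
  | allE t _ _ ih1 ih2 => exact inst_rename .. ▸ allE _ (ih1 hΔ) (ih2 hΔ)
  | exI t _ _ ih1 ih2 => exact exI _ (inst_rename .. ▸ ih1 hΔ) (ih2 hΔ)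
  | exE _ _ ih1 ih2 =>
    exact exE (ih1 hΔ) (shift_rename_liftRen .. ▸ ih2 (insert_mem _ (under_mem hΔ)))
  | eqI _ ih => exact eqI (ih hΔ)
  | eqE hA _ _ ih1 ih2 =>
    exact inst_rename .. ▸ eqE (hA.rename _) (ih1 hΔ) (inst_rename .. ▸ ih2 hΔ)
  | adRel i _ ih => exact adRel i (ih hΔ)
  | adEq1 _ ih => exact adEq1 (ih hΔ)
  | adEq2 _ ih => exact adEq2 (ih hΔ)
  | iotaI t _ _ _ _ ih1 ih2 ih3 ih4 =>
    exact iotaI _ (inst_rename .. ▸ ih1 hΔ) (inst_rename .. ▸ ih2 hΔ) (ih3 hΔ)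
      (tshift_relabel_liftRen .. ▸ ih4 (insert_mem _ (under_mem hΔ)))
  | iotaE1 _ _ ih1 ih2 =>
    exact iotaE1 (ih1 hΔ)
      (shift_rename_liftRen .. ▸ ih2 (insert_mem _ (insert_mem _ (under_mem hΔ))))
  | iotaE2 _ _ _ _ _ ih1 ih2 ih3 ih4 ih5 =>
    exact iotaE2 (ih1 hΔ) (ih2 hΔ) (ih3 hΔ) (inst_rename .. ▸ ih4 hΔ) (inst_rename .. ▸ ih5 hΔ)

theorem weaken (h : IProv Γ A) (hΔ : Γ ⊆ Δ) : IProv Δ A :=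
  rename_id A ▸ h.rename (ρ := id) fun B hB => (rename_id B).symm ▸ hΔ hB

theorem wk (h : IProv Γ A) : IProv (insert B Γ) A :=
  h.weaken (Set.subset_insert B Γ)

theorem hyp : IProv (insert A Γ) A :=
  ax (Set.mem_insert A Γ)

theorem cut (h : IProv Γ A) (h' : IProv (insert A Γ) B) : IProv Γ B :=
  impE (impI h') h

theorem under (h : IProv Γ A) : IProv (underBinder Γ) A.shift :=
  h.rename fun B hB => Set.mem_insert_of_mem _ ⟨B, hB, rfl⟩

theorem wk_under (h : IProv (underBinder Γ) A) : IProv (underBinder (insert B Γ)) A :=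
  h.weaken (Set.insert_subset_insert (Set.image_mono (Set.subset_insert B Γ)))

theorem under_under (h : IProv (underBinder Γ) A) :
    IProv (underBinder (underBinder Γ)) (A.rename (liftRen Nat.succ)) := by
  refine h.rename ?_
  rintro _ (rfl | ⟨B, hB, rfl⟩)
  · exact Set.mem_insert _ _
  · exact Set.mem_insert_of_mem _
      ⟨B.shift, Set.mem_insert_of_mem _ ⟨B, hB, rfl⟩, (shift_rename_liftRen B _).symm⟩

theorem all_shift_elim (h : IProv Γ (all A).shift) (h0 : IProv Γ (exi (.var 0))) : IProv Γ A :=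
  rename_liftRen_succ_inst_zero A ▸ allE (.var 0) h h0

theorem ex_shift_intro (h : IProv Γ A) (h0 : IProv Γ (exi (.var 0))) : IProv Γ (ex A).shift :=
  exI (.var 0) ((rename_liftRen_succ_inst_zero A).symm ▸ h) h0

theorem falsum_elim (h : IProv Γ falsum) (A : IForm L) : IProv Γ A := by
  suffices ∀ σ, IProv Γ (A.subst σ) by simpa only [subst_var] using this .var
  induction A generalizing Γ with
  | falsum => exact fun _ => h
  | rel R ts => exact fun _ => falsumE trivial h
  | exi t => exact fun _ => falsumE trivial h
  | eq s t => exact fun _ => falsumE trivial h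
  | and A B ihA ihB => exact fun σ => andI (ihA h σ) (ihB h σ)
  | or A B ihA => exact fun σ => orI1 (ihA h σ)
  | imp A B _ ihB => exact fun σ => impI (ihB h.wk σ)
  | all A ih => exact fun σ => allI (ih h.under _)
  | ex A ih =>
    exact fun σ => exI (.var 0) ((subst_inst ..).symm ▸ ih h _) (falsumE trivial h)
  | iota F G ihF ihG =>
    exact fun σ => iotaI (.var 0) ((subst_inst ..).symm ▸ ihF h _)
      ((subst_inst ..).symm ▸ ihG h _) (falsumE trivial h) (falsumE trivial h.under.wk)

theorem eq_symm (h : IProv Γ (eq s t)) : IProv Γ (eq t s) := by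
  have := eqE (A := eq (.var 0) (tshift s)) (s := s) (t := t) trivial h
  simp only [inst, subst, Term.subst, single, tshift_subst_single] at this
  exact this (eqI (adEq1 h))

theorem eq_trans (h : IProv Γ (eq s t)) (h' : IProv Γ (eq t u)) : IProv Γ (eq s u) := by
  have := eqE (A := eq (tshift s) (.var 0)) (s := t) (t := u) trivial h'
  simp only [inst, subst, Term.subst, single, tshift_subst_single] at this
  exact this h

section Biconditional

theorem iff_intro (h : IProv (insert A Γ) B) (h' : IProv (insert B Γ) A) :
    IProv Γ (IForm.iff A B) :=
  andI (impI h) (impI h')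

theorem iff_mp (h : IProv Γ (IForm.iff A B)) (hA : IProv Γ A) : IProv Γ B :=
  impE (andE1 h) hA

theorem iff_mpr (h : IProv Γ (IForm.iff A B)) (hB : IProv Γ B) : IProv Γ A :=
  impE (andE2 h) hB

theorem iff_refl : IProv Γ (IForm.iff A A) :=
  iff_intro hyp hyp

theorem iff_symm (h : IProv Γ (IForm.iff A B)) : IProv Γ (IForm.iff B A) :=
  andI (andE2 h) (andE1 h)

theorem iff_trans (h : IProv Γ (IForm.iff A B)) (h' : IProv Γ (IForm.iff B C)) :
    IProv Γ (IForm.iff A C) :=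
  iff_intro (h'.wk.iff_mp (h.wk.iff_mp hyp)) (h.wk.iff_mpr (h'.wk.iff_mpr hyp))

theorem and_congr (hA : IProv Γ (IForm.iff A A')) (hB : IProv Γ (IForm.iff B B')) :
    IProv Γ (IForm.iff (and A B) (and A' B')) :=
  iff_intro (andI (hA.wk.iff_mp (andE1 hyp)) (hB.wk.iff_mp (andE2 hyp)))
    (andI (hA.wk.iff_mpr (andE1 hyp)) (hB.wk.iff_mpr (andE2 hyp)))

theorem or_congr (hA : IProv Γ (IForm.iff A A')) (hB : IProv Γ (IForm.iff B B')) :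
    IProv Γ (IForm.iff (or A B) (or A' B')) :=
  iff_intro (orE hyp (orI1 (hA.wk.wk.iff_mp hyp)) (orI2 (hB.wk.wk.iff_mp hyp)))
    (orE hyp (orI1 (hA.wk.wk.iff_mpr hyp)) (orI2 (hB.wk.wk.iff_mpr hyp)))

theorem imp_congr (hA : IProv Γ (IForm.iff A A')) (hB : IProv Γ (IForm.iff B B')) :
    IProv Γ (IForm.iff (imp A B) (imp A' B')) :=
  iff_intro (impI (hB.wk.wk.iff_mp (impE hyp.wk (hA.wk.wk.iff_mpr hyp))))
    (impI (hB.wk.wk.iff_mpr (impE hyp.wk (hA.wk.wk.iff_mp hyp))))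

theorem all_congr (h : IProv (underBinder Γ) (IForm.iff A A')) :
    IProv Γ (IForm.iff (all A) (all A')) :=
  iff_intro (allI (h.wk_under.iff_mp (hyp.under.all_shift_elim hyp)))
    (allI (h.wk_under.iff_mpr (hyp.under.all_shift_elim hyp)))

theorem ex_congr (h : IProv (underBinder Γ) (IForm.iff A A')) :
    IProv Γ (IForm.iff (ex A) (ex A')) :=
  iff_intro (exE hyp (ex_shift_intro (h.wk_under.wk.iff_mp hyp) hyp.wk))
    (exE hyp (ex_shift_intro (h.wk_under.wk.iff_mpr hyp) hyp.wk))

theorem eq_iff_comm : IProv Γ (IForm.iff (eq s t) (eq t s)) :=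
  iff_intro hyp.eq_symm hyp.eq_symm

theorem eq_iff_of_eq (h : IProv Γ (eq s t)) : IProv Γ (IForm.iff (eq u s) (eq u t)) :=
  iff_intro (hyp.eq_trans h.wk) (hyp.eq_trans h.wk.eq_symm)

end Biconditional

section Iota

theorem iota_mono (hF : IProv (underBinder Γ) (IForm.iff F F'))
    (hG : IProv (underBinder Γ) (IForm.iff G G')) (h : IProv Γ (iota F G)) :
    IProv Γ (iota F' G') := by
  have inst_zero {Δ : Set (IForm L)} {A : IForm L} (h : IProv Δ A) :
      IProv Δ ((A.rename (liftRen Nat.succ)).inst (.var 0)) :=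
    (rename_liftRen_succ_inst_zero A).symm ▸ h
  refine iotaE1 h (iotaI (.var 0) (inst_zero (hF.wk.wk.iff_mp hyp))
    (inst_zero (hG.wk.wk.iff_mp hyp.wk)) hyp.wk.wk ?_)
  have hFz : IProv (insert F (insert G (underBinder Γ)))
      ((F.rename (liftRen Nat.succ)).inst (.var 0)) := inst_zero hyp
  refine iotaE2 h.under.wk.wk.under.wk hyp.wk hyp.wk.wk.under.wk ?_ ?_
  · exact inst_zero (hF.under_under.wk_under.wk_under.wk.iff_mpr hyp)
  · exact inst_shift .. ▸ hFz.under.wk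

theorem iota_congr (hF : IProv (underBinder Γ) (IForm.iff F F'))
    (hG : IProv (underBinder Γ) (IForm.iff G G')) :
    IProv Γ (IForm.iff (iota F G) (iota F' G')) :=
  iff_intro (iota_mono hF.wk_under hG.wk_under hyp)
    (iota_mono hF.wk_under.iff_symm hG.wk_under.iff_symm hyp)

end Iota

section Leibniz

theorem atomic_inst_iff_of_eq (hA : A.IsAtomic) (h : IProv Γ (eq s t)) :
    IProv Γ (IForm.iff (A.inst s) (A.inst t)) :=
  iff_intro (eqE hA h.wk hyp) (eqE hA h.wk.eq_symm hyp)

-- The substitution `κ` lets the induction pass a binder: `swap` brings the variable of the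
-- instance back to the index `0`.
theorem subst_inst_iff_of_eq (h : IProv Γ (eq s t)) (A : IForm L) (κ : ℕ → L.Term ℕ) :
    IProv Γ (IForm.iff ((A.subst κ).inst s) ((A.subst κ).inst t)) := by
  induction A generalizing Γ s t κ with
  | falsum => exact iff_refl
  | rel R ts => exact atomic_inst_iff_of_eq (A := (rel R ts).subst κ) trivial h
  | exi r => exact atomic_inst_iff_of_eq (A := (exi r).subst κ) trivial h
  | eq r r' => exact atomic_inst_iff_of_eq (A := (eq r r').subst κ) trivial h
  | and A B ihA ihB => exact and_congr (ihA h κ) (ihB h κ)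
  | or A B ihA ihB => exact or_congr (ihA h κ) (ihB h κ)
  | imp A B ihA ihB => exact imp_congr (ihA h κ) (ihB h κ)
  | all A ih =>
    refine all_congr ?_
    simp only [subst_subst_liftSub_single]
    exact ih h.under _
  | ex A ih =>
    refine ex_congr ?_
    simp only [subst_subst_liftSub_single]
    exact ih h.under _
  | iota F G ihF ihG =>
    refine iota_congr ?_ ?_ <;> simp only [subst_subst_liftSub_single]
    · exact ihF h.under _
    · exact ihG h.under _

theorem inst_iff_of_eq (A : IForm L) (h : IProv Γ (eq s t)) :
    IProv Γ (IForm.iff (A.inst s) (A.inst t)) := by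
  simpa only [subst_var] using subst_inst_iff_of_eq h A .var

end Leibniz

section IotaIdentity

theorem iota_change (h : IProv Γ (iota F G)) (hF : IProv Γ (F.inst t)) (ht : IProv Γ (exi t))
    (hG : IProv Γ (G'.inst t)) : IProv Γ (iota F G') := by
  refine iotaI t hF hG ht (iotaE2 h.under.wk hyp.wk ht.under.wk ?_ ?_)
  · exact (rename_liftRen_succ_inst_zero F).symm ▸ hyp
  · exact inst_shift F t ▸ hF.under.wk

theorem inst_iff_of_var_eq (A : IForm L) (h : IProv Γ (eq (.var 0) (tshift t))) :
    IProv Γ (IForm.iff A (A.inst t).shift) := by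
  simpa only [rename_liftRen_succ_inst_zero, inst_shift]
    using inst_iff_of_eq (A.rename (liftRen Nat.succ)) h

theorem exi_of_iota_eq (h : IProv Γ (iota F (eq (.var 0) (tshift t)))) : IProv Γ (exi t) :=
  iotaE1 h (adEq2 (s := .var 0) hyp.wk)

theorem inst_of_iota_eq (h : IProv Γ (iota F (eq (.var 0) (tshift t)))) : IProv Γ (F.inst t) :=
  iotaE1 h ((inst_iff_of_var_eq F hyp.wk).iff_mp hyp)

theorem eq_inst_of_exi (ht : IProv Γ (exi t)) : IProv Γ ((eq (.var 0) (tshift t)).inst t) := by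
  simpa only [inst, subst, Term.subst, single, tshift_subst_single] using eqI ht

theorem iota_eq_of_iota (h : IProv Γ (iota F G)) (hF : IProv Γ (F.inst t)) (ht : IProv Γ (exi t)) :
    IProv Γ (iota F (eq (.var 0) (tshift t))) :=
  h.iota_change hF ht (eq_inst_of_exi ht)

theorem iota_of_iota_eq (h : IProv Γ (iota F (eq (.var 0) (tshift t)))) (hG : IProv Γ (G.inst t)) :
    IProv Γ (iota F G) :=
  h.iota_change h.inst_of_iota_eq h.exi_of_iota_eq hG

theorem iota_iff_ex : IProv Γ (IForm.iff (iota F G)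
    (ex (and (iota (F.rename (liftRen Nat.succ)) (eq (.var 0) (.var 1))) G))) := by
  refine iff_intro (iotaE1 hyp (ex_shift_intro (andI ?_ hyp.wk) hyp.wk.wk)) (exE hyp ?_)
  · refine iota_eq_of_iota (t := .var 0) hyp.under.wk.wk ?_ hyp.wk.wk
    exact (rename_liftRen_succ_inst_zero F).symm ▸ hyp
  · refine iota_of_iota_eq (t := .var 0) (andE1 hyp) ?_
    exact (rename_liftRen_succ_inst_zero G).symm ▸ andE2 hyp

theorem iota_eq_iff_all (ht : IProv Γ (exi t)) :
    IProv Γ (IForm.iff (iota F (eq (.var 0) (tshift t)))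
      (all (IForm.iff F (eq (.var 0) (tshift t))))) := by
  refine iff_intro (allI (iff_intro ?_ ?_)) (iotaI t ?_ (eq_inst_of_exi ht.wk) ht.wk ?_)
  · refine iotaE2 hyp.under.wk hyp.wk ht.wk.under.wk ?_ ?_
    · exact (rename_liftRen_succ_inst_zero F).symm ▸ hyp
    · exact inst_shift F t ▸ hyp.inst_of_iota_eq.under.wk
  · exact (inst_iff_of_var_eq F hyp).iff_mpr hyp.inst_of_iota_eq.under.wk
  · exact (allE t hyp ht.wk).iff_mpr (eq_inst_of_exi ht.wk)
  · exact (hyp.under.wk.all_shift_elim hyp.wk).iff_mp hyp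

theorem iota_eq_iff_eq (h : IProv Γ (iota F (eq (.var 0) (tshift s)))) :
    IProv Γ (IForm.iff (iota F (eq (.var 0) (tshift t))) (eq s t)) :=
  iff_intro
    (iotaE2 hyp h.wk.exi_of_iota_eq hyp.exi_of_iota_eq h.wk.inst_of_iota_eq hyp.inst_of_iota_eq)
    (h.wk.iota_eq_of_iota ((inst_iff_of_eq F hyp).iff_mp h.wk.inst_of_iota_eq) (adEq2 hyp))

theorem iota_eq_eq_iff_eq :
    IProv Γ (IForm.iff (iota (eq (tshift s) (.var 0)) (eq (.var 0) (tshift t))) (eq s t)) := by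
  refine iff_intro ?_ ((iota_eq_iff_all (adEq2 hyp)).iff_mpr (allI ?_))
  · have := inst_of_iota_eq (hyp (A := iota (eq (tshift s) (.var 0)) (eq (.var 0) (tshift t)))
      (Γ := Γ))
    simpa only [inst, subst, Term.subst, single, tshift_subst_single] using this
  · exact eq_iff_comm.iff_trans (eq_iff_of_eq hyp.under)

end IotaIdentity

end IProv

section Abstraction

variable {L : FirstOrder.Language.{u, v}}

theorem DTerm.ord_subst_ord (σ : ℕ → L.Term ℕ) (t : L.Term ℕ) :
    (DTerm.ord t).subst (fun i => .ord (σ i)) = .ord (t.subst σ) := by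
  cases t <;> simp only [DTerm.subst, DTerm.toTerm, Term.subst]

theorem DTerm.iota_subst (σ : ℕ → DTerm L) (A : DForm L) :
    (DTerm.iota A).subst σ = .iota (A.subst (liftDSub σ)) := by
  simp only [DTerm.subst]

theorem liftDSub_ord (σ : ℕ → L.Term ℕ) :
    liftDSub (fun i => .ord (σ i)) = fun i => .ord (liftSub σ i) := by
  funext i
  cases i with
  | zero => rfl
  | succ i => simp only [liftDSub, liftSub, DTerm.shift, DTerm.rename, tshift]

theorem dsingle_ord (t : L.Term ℕ) : dsingle (.ord t) = fun i => .ord (single t i) := by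
  funext i
  cases i <;> rfl

namespace DForm

theorem rename_eq_subst (A : DForm L) (ρ : ℕ → ℕ) :
    A.rename ρ = A.subst fun i => .ord (.var (ρ i)) := by
  induction A using DForm.rec (motive_1 := fun t => ∀ ρ : ℕ → ℕ,
    t.rename ρ = t.subst fun i => .ord (.var (ρ i))) generalizing ρ <;>
    simp_all only [rename, subst, DTerm.rename, DTerm.ord_subst_ord, DTerm.iota_subst,
      DTerm.toTerm, term_relabel_eq_subst, liftDSub_ord, liftSub_var_comp]

theorem subst_subst_ord (A : DForm L) (σ π : ℕ → L.Term ℕ) :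
    (A.subst fun i => .ord (σ i)).subst (fun i => .ord (π i)) =
      A.subst fun i => .ord ((σ i).subst π) := by
  induction A using DForm.rec (motive_1 := fun t => ∀ σ π : ℕ → L.Term ℕ,
    (t.subst fun i => .ord (σ i)).subst (fun i => .ord (π i)) =
      t.subst fun i => .ord ((σ i).subst π)) generalizing σ π <;>
    simp_all only [subst, DTerm.ord_subst_ord, DTerm.iota_subst, DTerm.toTerm,
      term_subst_subst, liftDSub_ord, liftSub_subst_liftSub]

theorem subst_var (A : DForm L) : (A.subst fun i => .ord (.var i)) = A := by
  induction A using DForm.rec (motive_1 := fun t => (t.subst fun i => .ord (.var i)) = t) <;>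
    simp_all only [subst, DTerm.ord_subst_ord, DTerm.iota_subst, DTerm.toTerm, term_subst_var,
      liftDSub_ord, liftSub_var]

theorem rename_rename (A : DForm L) (ρ π : ℕ → ℕ) :
    (A.rename ρ).rename π = A.rename fun i => π (ρ i) := by
  simp only [rename_eq_subst, subst_subst_ord, Term.subst]

end DForm

theorem liftRen_liftRen (ρ π : ℕ → ℕ) (i : ℕ) :
    liftRen π (liftRen ρ i) = liftRen (fun i => π (ρ i)) i := by
  cases i <;> rfl

theorem DTerm.rename_rename (t : DTerm L) (ρ π : ℕ → ℕ) :
    (t.rename ρ).rename π = t.rename fun i => π (ρ i) := by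
  cases t <;> simp only [DTerm.rename, DForm.rename_rename, liftRen_liftRen, Term.relabel_relabel]
  rfl

end Abstraction

section Tau

variable {L : FirstOrder.Language.{u, v}}

theorem IForm.subst_liftSub_rename_liftRen_succ (A : IForm L) (σ : ℕ → L.Term ℕ) :
    (A.subst (liftSub σ)).rename (liftRen Nat.succ) =
      (A.rename (liftRen Nat.succ)).subst (liftSub (liftSub σ)) := by
  simp only [rename_eq_subst, subst_subst]
  congr 1
  funext i
  cases i with
  | zero => rfl
  | succ i =>
    simp only [liftSub, tshift_eq_subst, term_subst_subst, liftRen, Term.subst]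

theorem tau_subst_ord (A : DForm L) (σ : ℕ → L.Term ℕ) :
    tau (A.subst fun i => .ord (σ i)) = (tau A).subst σ := by
  fun_induction tau A generalizing σ <;>
    simp_all only [DForm.subst, DTerm.ord_subst_ord, DTerm.iota_subst, DTerm.toTerm,
      liftDSub_ord, tau, IForm.subst, tshift_subst_liftSub,
      IForm.subst_liftSub_rename_liftRen_succ] <;> rfl

theorem tau_rename (A : DForm L) (ρ : ℕ → ℕ) : tau (A.rename ρ) = (tau A).rename ρ := by
  rw [DForm.rename_eq_subst, IForm.rename_eq_subst, tau_subst_ord]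

theorem tau_shift (A : DForm L) : tau A.shift = (tau A).shift :=
  tau_rename A Nat.succ

theorem tau_image_shift (Γ : Set (DForm L)) :
    tau '' (DForm.shift '' Γ) = IForm.shift '' (tau '' Γ) := by
  simp only [Set.image_image, tau_shift]

theorem tau_inst_ord (A : DForm L) (t : L.Term ℕ) : tau (A.inst (.ord t)) = (tau A).inst t := by
  rw [DForm.inst, dsingle_ord, tau_subst_ord, IForm.inst]

/-- The formula saying that `t` denotes the variable `0` of a binder put in front of it. For an
ordinary term it is an identity, and for `ι x A` it says that the `A` is the value of `0`. -/
def graph (t : DTerm L) : IForm L := tau (.eq t.shift (.var 0))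

theorem graph_ord (t : L.Term ℕ) : graph (.ord t) = .eq (tshift t) (.var 0) := by
  simp only [graph, DTerm.shift, DTerm.rename, DTerm.var, tau, tshift]

theorem graph_iota (A : DForm L) :
    graph (.iota A) = .iota ((tau A).rename (liftRen Nat.succ)) (.eq (.var 0) (.var 1)) := by
  simp only [graph, DTerm.shift, DTerm.rename, DTerm.var, tau, tau_rename]
  rfl

theorem graph_rename (t : DTerm L) (ρ : ℕ → ℕ) :
    (graph t).rename (liftRen ρ) = graph (t.rename ρ) := by
  simp only [graph, ← tau_rename, DForm.rename, DTerm.shift, DTerm.rename_rename]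
  rfl

end Tau

namespace IProv

open IForm

variable {L : FirstOrder.Language.{u, v}} {Γ : Set (IForm L)} {A B B' : IForm L}

theorem and_iff_comm : IProv Γ (IForm.iff (and A B) (and B A)) :=
  iff_intro (andI (andE2 hyp) (andE1 hyp)) (andI (andE2 hyp) (andE1 hyp))

theorem iff_and_of_right (h : IProv Γ B) : IProv Γ (IForm.iff (and A B) A) :=
  iff_intro (andE1 hyp) (andI hyp h.wk)

theorem and_congr_right (h : IProv (insert A Γ) (IForm.iff B B')) :
    IProv Γ (IForm.iff (and A B) (and A B')) :=
  iff_intro (cut (andE1 hyp) (andI hyp ((h.weaken (Set.insert_subset_insert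
    (Set.subset_insert _ Γ))).iff_mp (andE2 hyp.wk))))
    (cut (andE1 hyp) (andI hyp ((h.weaken (Set.insert_subset_insert
    (Set.subset_insert _ Γ))).iff_mpr (andE2 hyp.wk))))

theorem ex_and_shift_iff : IProv Γ (IForm.iff (ex (and A B.shift)) (and (ex A) B)) :=
  iff_intro
    (andI (exE hyp (ex_shift_intro (andE1 hyp) hyp.wk)) (exE hyp (andE2 hyp)))
    (exE (andE1 hyp) (ex_shift_intro (andI hyp (andE2 hyp.under.wk)) hyp.wk))

theorem exi_iff_ex (t : L.Term ℕ) : IProv Γ (IForm.iff (exi t) (ex (eq (tshift t) (.var 0)))) := by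
  refine iff_intro (exI t ?_ hyp) (exE hyp (adEq1 hyp))
  simpa only [inst, subst, Term.subst, single, tshift_subst_single] using eqI hyp

theorem eq_iff_ex (s t : L.Term ℕ) : IProv Γ (IForm.iff (eq s t)
    (ex (and (eq (tshift s) (.var 0)) (eq (tshift t) (.var 0))))) := by
  refine iff_intro (exI t ?_ (adEq2 hyp)) (exE hyp ((andE1 hyp).eq_trans (andE2 hyp).eq_symm))
  simpa only [inst, subst, Term.subst, single, tshift_subst_single]
    using andI hyp (eqI (adEq2 hyp))

theorem tau_exi_iff (t : DTerm L) : IProv Γ (IForm.iff (tau (.exi t)) (ex (graph t))) := by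
  cases t with
  | ord t =>
    simp only [tau, graph_ord]
    exact exi_iff_ex t
  | iota A =>
    simp only [tau, graph_iota]
    exact iota_iff_ex.iff_trans (ex_congr (iff_and_of_right hyp))

theorem tau_eq_iff (s t : DTerm L) :
    IProv Γ (IForm.iff (tau (.eq s t)) (ex (and (graph s) (graph t)))) := by
  cases s <;> cases t <;> simp only [tau, graph_ord, graph_iota]
  case ord.ord s t => exact eq_iff_ex s t
  case iota.ord A t => exact iota_iff_ex.iff_trans (ex_congr (and_congr iff_refl eq_iff_comm))
  case ord.iota s B => exact iota_iff_ex.iff_trans (ex_congr and_iff_comm)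
  case iota.iota A B =>
    exact iota_iff_ex.iff_trans
      (ex_congr (and_congr iff_refl (iota_congr iff_refl eq_iff_comm)))

theorem tau_delta_iff (B : DForm L) (t : DTerm L) :
    IProv Γ (IForm.iff (tau (.delta B t)) (ex (and (graph t) (tau B)))) := by
  cases t with
  | ord t =>
    simp only [tau, graph_ord]
    refine iota_iff_ex.iff_trans (ex_congr (and_congr ?_ iff_refl))
    simp only [IForm.rename, tshift_relabel_liftRen]
    exact iota_eq_eq_iff_eq (s := tshift t) (t := .var 0)
  | iota A =>
    simp only [tau, graph_iota]
    exact iota_iff_ex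

theorem graph_shift_iff_of_graph {t : DTerm L} (h : IProv Γ (graph t)) :
    IProv (underBinder Γ) (IForm.iff (graph t.shift) (eq (.var 1) (.var 0))) := by
  cases t with
  | ord t =>
    have ht : IProv (underBinder Γ) (eq (tshift (tshift t)) (.var 1)) := (graph_ord t ▸ h).under
    exact graph_ord (tshift t) ▸ eq_iff_comm.iff_trans ((eq_iff_of_eq ht).iff_trans eq_iff_comm)
  | iota A =>
    have hA : IProv (underBinder Γ) (iota _ (eq (.var 0) (tshift (.var 1)))) :=
      (graph_iota A ▸ h).under
    simp only [DTerm.shift, DTerm.rename, graph_iota, tau_rename]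
    exact iota_eq_iff_eq (t := .var 0) hA

end IProv

section Replacement

open IForm

variable {L : FirstOrder.Language.{u, v}} {Γ : Set (IForm L)} {n : ℕ} {σ : ℕ → DTerm L}
  {ρ : ℕ → ℕ} {π : ℕ → L.Term ℕ} {A B : DForm L} {s s' t t' : DTerm L}

/-- `s` and `t` provably, from `Γ`, denote the same individual, if any: the relation between terms
under which `τ` is a congruence. It is weaker than `s = t`, which implies that both exist. -/
def Codenotes (Γ : Set (IForm L)) (s t : DTerm L) : Prop :=
  IProv (underBinder Γ) (IForm.iff (graph s) (graph t))

namespace Codenotes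

theorem under (h : Codenotes Γ s t) : Codenotes (underBinder Γ) s.shift t.shift := by
  have := h.under_under
  rwa [IForm.iff, IForm.rename, IForm.rename, IForm.rename, graph_rename, graph_rename] at this

theorem iota (h : IProv (underBinder Γ) (IForm.iff (tau A) (tau B))) :
    Codenotes Γ (.iota A) (.iota B) := by
  rw [Codenotes, graph_iota, graph_iota]
  exact IProv.iota_congr h.under_under .iff_refl

theorem tau_exi_congr (h : Codenotes Γ s t) :
    IProv Γ (IForm.iff (tau (.exi s)) (tau (.exi t))) :=
  (IProv.tau_exi_iff s).iff_trans (h.ex_congr.iff_trans (IProv.tau_exi_iff t).iff_symm)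

theorem tau_eq_congr (hs : Codenotes Γ s s') (ht : Codenotes Γ t t') :
    IProv Γ (IForm.iff (tau (.eq s t)) (tau (.eq s' t'))) :=
  (IProv.tau_eq_iff s t).iff_trans
    ((hs.and_congr ht).ex_congr.iff_trans (IProv.tau_eq_iff s' t').iff_symm)

theorem tau_delta_congr (ht : Codenotes Γ s t)
    (h : IProv (underBinder Γ) (IForm.iff (tau A) (tau B))) :
    IProv Γ (IForm.iff (tau (.delta A s)) (tau (.delta B t))) :=
  (IProv.tau_delta_iff A s).iff_trans
    ((ht.and_congr h).ex_congr.iff_trans (IProv.tau_delta_iff B t).iff_symm)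

end Codenotes

/-- Following `σ` by the renaming `ρ` gives the substitution `π` of ordinary terms, but for the
variable `n`, where a codenoting term may stand. The renaming is kept apart from `σ` because it does
not commute with the dummy value of `DTerm.toTerm`. -/
structure AgreesExceptAt (Γ : Set (IForm L)) (n : ℕ) (σ : ℕ → DTerm L) (ρ : ℕ → ℕ)
    (π : ℕ → L.Term ℕ) : Prop where
  rename_eq : ∀ i ≠ n, (σ i).rename ρ = .ord (π i)
  codenotes : Codenotes Γ ((σ n).rename ρ) (.ord (π n))

theorem DTerm.shift_rename_liftRen (t : DTerm L) (ρ : ℕ → ℕ) :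
    t.shift.rename (liftRen ρ) = (t.rename ρ).shift := by
  simp only [DTerm.shift, DTerm.rename_rename]
  rfl

namespace AgreesExceptAt

theorem under (h : AgreesExceptAt Γ n σ ρ π) :
    AgreesExceptAt (underBinder Γ) (n + 1) (liftDSub σ) (liftRen ρ) (liftSub π) where
  rename_eq
    | 0, _ => rfl
    | i + 1, hi => by
      rw [liftDSub, DTerm.shift_rename_liftRen, h.rename_eq i (ne_of_apply_ne _ hi)]
      rfl
  codenotes := by
    rw [liftDSub, DTerm.shift_rename_liftRen]
    exact h.codenotes.under

theorem relabel_subst_eq (h : AgreesExceptAt Γ n σ ρ π) {t : L.Term ℕ} (hn : n ∉ t.varFinset) :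
    (t.subst fun i => (σ i).toTerm).relabel ρ = t.subst π := by
  rw [term_relabel_eq_subst, term_subst_subst]
  refine term_subst_congr fun i hi => ?_
  have hσ := h.rename_eq i (ne_of_mem_of_not_mem hi hn)
  rw [← term_relabel_eq_subst]
  cases hi : σ i with
  | ord s => simpa only [hi, DTerm.rename, DTerm.toTerm, DTerm.ord.injEq] using hσ
  | iota A => simp only [hi, DTerm.rename, reduceCtorEq] at hσ

theorem codenotes_ord (h : AgreesExceptAt Γ n σ ρ π) {t : L.Term ℕ}
    (hn : (DTerm.ord t).Iotable n) :
    Codenotes Γ (((DTerm.ord t).subst σ).rename ρ) ((DTerm.ord t).subst fun i => .ord (π i)) := by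
  cases t with
  | var i =>
    simp only [DTerm.subst]
    by_cases hi : i = n
    · exact hi ▸ h.codenotes
    · exact h.rename_eq i hi ▸ .iff_refl
  | func f ts =>
    rw [DTerm.ord_subst_ord, DTerm.subst, DTerm.rename,
      h.relabel_subst_eq (by simpa only [DTerm.Iotable] using hn)]
    exact .iff_refl

theorem tau_iff (h : AgreesExceptAt Γ n σ ρ π) (hA : A.Iotable n) :
    IProv Γ (IForm.iff (tau ((A.subst σ).rename ρ)) (tau (A.subst fun i => .ord (π i)))) := by
  induction A using DForm.rec (motive_1 := fun t => ∀ {Γ n σ ρ π}, AgreesExceptAt Γ n σ ρ π →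
      t.Iotable n →
      Codenotes Γ ((t.subst σ).rename ρ) (t.subst fun i => .ord (π i)))
    generalizing Γ n σ ρ π <;>
    simp only [DForm.subst, DForm.rename, DForm.Iotable, DTerm.iota_subst, DTerm.rename,
      DTerm.Iotable, liftDSub_ord, tau, DTerm.toTerm] at *
  case ord h ht => exact h.codenotes_ord ht
  case iota ih _ _ _ _ _ h hA => exact Codenotes.iota (ih h.under hA)
  case falsum => exact .iff_refl
  case rel R ts => exact (funext fun i => h.relabel_subst_eq (hA i)) ▸ .iff_refl
  case exi t ih => exact (ih h hA).tau_exi_congr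
  case eq s t ihs iht => exact (ihs h hA.1).tau_eq_congr (iht h hA.2)
  case and A B ihA ihB => exact (ihA h hA.1).and_congr (ihB h hA.2)
  case or A B ihA ihB => exact (ihA h hA.1).or_congr (ihB h hA.2)
  case imp A B ihA ihB => exact (ihA h hA.1).imp_congr (ihB h hA.2)
  case all A ih => exact (ih h.under hA).all_congr
  case ex A ih => exact (ih h.under hA).ex_congr
  case delta B t ihB iht => exact (iht h hA.2).tau_delta_congr (ihB h.under hA.1)

end AgreesExceptAt

theorem tau_inst_shift_iff (hA : A.Admits t) (ht : IProv Γ (graph t)) :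
    IProv Γ (IForm.iff (tau (A.inst t)).shift (tau A)) := by
  cases t with
  | ord t =>
    rw [tau_inst_ord]
    exact (IProv.inst_iff_of_var_eq (tau A) (graph_ord t ▸ ht).eq_symm).iff_symm
  | iota F =>
    have h : AgreesExceptAt Γ 0 (dsingle (.iota F)) Nat.succ .var :=
      { rename_eq := fun i hi => by cases i <;> trivial
        codenotes := by
          rw [Codenotes, graph_ord]
          exact IProv.graph_shift_iff_of_graph ht }
    simpa only [DForm.inst, ← tau_shift, DForm.shift, tau_subst_ord, subst_var]
      using h.tau_iff hA

theorem tau_lambert (F : DForm L) : IProv Γ (tau (.lambert F)) :=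
  .allI (IProv.iota_eq_iff_all (t := .var 0) .hyp)

theorem tau_absTerm (hB : B.Admits t) : IProv Γ (tau (.absTerm B t)) := by
  refine (IProv.tau_delta_iff B t).iff_trans ?_
  refine (IProv.and_congr_right (tau_inst_shift_iff hB .hyp).iff_symm).ex_congr.iff_trans ?_
  exact IProv.ex_and_shift_iff.iff_trans ((IProv.tau_exi_iff t).iff_symm.and_congr .iff_refl)

theorem tau_absIota (A B : DForm L) : IProv Γ (tau (.absIota A B)) :=
  IProv.tau_delta_iff B (.iota A)

theorem DProv.tau {Γ : Set (DForm L)} {A : DForm L} (h : DProv Γ A) :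
    IProv (tau '' Γ) (tau A) := by
  induction h with
  | ax h => exact .ax ⟨_, h, rfl⟩
  | andI _ _ ih1 ih2 => exact .andI ih1 ih2
  | andE1 _ ih => exact .andE1 ih
  | andE2 _ ih => exact .andE2 ih
  | impI _ ih =>
    rw [Set.image_insert_eq] at ih
    exact .impI ih
  | impE _ _ ih1 ih2 => exact .impE ih1 ih2
  | orI1 _ ih => exact .orI1 ih
  | orI2 _ ih => exact .orI2 ih
  | orE _ _ _ ih ih1 ih2 =>
    rw [Set.image_insert_eq] at ih1 ih2
    exact .orE ih ih1 ih2
  | falsumE _ _ ih => exact ih.falsum_elim _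
  | allI _ ih =>
    rw [Set.image_insert_eq, tau_image_shift] at ih
    exact .allI ih
  | allE t hA _ _ ih1 ih2 =>
    exact .exE ((IProv.tau_exi_iff t).iff_mp ih2)
      ((tau_inst_shift_iff hA .hyp).iff_mpr (ih1.under.wk.all_shift_elim IProv.hyp.wk))
  | exI t hA _ _ ih1 ih2 =>
    exact .exE ((IProv.tau_exi_iff t).iff_mp ih2)
      (.ex_shift_intro ((tau_inst_shift_iff hA .hyp).iff_mp ih1.under.wk) IProv.hyp.wk)
  | exE _ _ ih1 ih2 =>
    rw [Set.image_insert_eq, Set.image_insert_eq, tau_image_shift, tau_shift] at ih2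
    exact .exE ih1 ih2
  | @eqI _ t _ ih =>
    exact (IProv.tau_eq_iff t t).iff_mpr (.exE ((IProv.tau_exi_iff t).iff_mp ih)
      (.ex_shift_intro (.andI .hyp .hyp) IProv.hyp.wk))
  | @eqE _ _ s t _ hs ht _ _ ih1 ih2 =>
    exact .exE ((IProv.tau_eq_iff s t).iff_mp ih1)
      ((tau_inst_shift_iff ht (.andE2 .hyp)).iff_mpr
        ((tau_inst_shift_iff hs (.andE1 .hyp)).iff_mp ih2.under.wk))
  | adRel i _ ih => exact .adRel i ih
  | @adEq1 _ s t _ ih =>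
    exact (IProv.tau_exi_iff s).iff_mpr (.exE ((IProv.tau_eq_iff s t).iff_mp ih)
      (.ex_shift_intro (.andE1 .hyp) IProv.hyp.wk))
  | @adEq2 _ s t _ ih =>
    exact (IProv.tau_exi_iff t).iff_mpr (.exE ((IProv.tau_eq_iff s t).iff_mp ih)
      (.ex_shift_intro (.andE2 .hyp) IProv.hyp.wk))
  | lambert F => exact tau_lambert F
  | absTerm B t hB => exact tau_absTerm hB
  | absIota A B => exact tau_absIota A B

end Replacement

section Upsilon

variable {L : FirstOrder.Language.{u, v}}

theorem upsilon_subst (A : IForm L) (σ : ℕ → L.Term ℕ) :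
    upsilon (A.subst σ) = (upsilon A).subst fun i => .ord (σ i) := by
  induction A generalizing σ <;>
    simp_all only [upsilon, IForm.subst, DForm.subst, DTerm.ord_subst_ord, DTerm.iota_subst,
      DTerm.toTerm, liftDSub_ord]

theorem upsilon_shift (A : IForm L) : upsilon A.shift = (upsilon A).shift := by
  rw [IForm.shift, IForm.rename_eq_subst, upsilon_subst, DForm.shift, DForm.rename_eq_subst]

theorem upsilon_image_shift (Γ : Set (IForm L)) :
    upsilon '' (IForm.shift '' Γ) = DForm.shift '' (upsilon '' Γ) := by
  simp only [Set.image_image, upsilon_shift]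

theorem upsilon_inst (A : IForm L) (t : L.Term ℕ) :
    upsilon (A.inst t) = (upsilon A).inst (.ord t) := by
  rw [IForm.inst, upsilon_subst, DForm.inst, dsingle_ord]

theorem IForm.IsAtomic.upsilon {A : IForm L} (h : A.IsAtomic) : (upsilon A).IsAtomic := by
  cases A <;> exact h

end Upsilon

namespace DForm

variable {L : FirstOrder.Language.{u, v}}

theorem rename_liftRen_succ_inst_zero (A : DForm L) :
    (A.rename (liftRen Nat.succ)).inst (.var 0) = A := by
  rw [rename_eq_subst, inst, DTerm.var, dsingle_ord, subst_subst_ord]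
  convert subst_var A using 3 with i
  cases i <;> rfl

theorem rename_liftRen_succ_subst_single (A : DForm L) (t : L.Term ℕ) :
    (A.rename (liftRen Nat.succ)).subst (liftDSub (dsingle (.ord t))) = A := by
  rw [rename_eq_subst, dsingle_ord, liftDSub_ord, subst_subst_ord]
  convert subst_var A using 3 with i
  cases i <;> rfl

theorem shift_inst (A : DForm L) (t : L.Term ℕ) : A.shift.inst (.ord t) = A := by
  rw [shift, rename_eq_subst, inst, dsingle_ord, subst_subst_ord]
  exact subst_var A

theorem inst_shift (A : DForm L) (t : L.Term ℕ) :
    (A.inst (.ord t)).shift = (A.rename (liftRen Nat.succ)).inst (.ord (tshift t)) := by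
  simp only [shift, inst, rename_eq_subst, dsingle_ord, subst_subst_ord]
  congr 1
  funext i
  cases i with
  | zero => exact congrArg _ (tshift_eq_subst t).symm
  | succ i => rfl

theorem shift_subst_liftDSub_single (A : DForm L) (t : L.Term ℕ) :
    A.shift.subst (liftDSub (dsingle (.ord t))) = (A.inst (.ord t)).shift := by
  simp only [shift, inst, rename_eq_subst, dsingle_ord, liftDSub_ord, subst_subst_ord]
  congr 1
  funext i
  exact congrArg _ (tshift_eq_subst _)

/-- The assumptions `Γ` carried under a binder, whose variable `0` may be assumed to exist: the
context of the subdeduction in a rule with an eigenvariable. -/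
abbrev underBinder (Γ : Set (DForm L)) : Set (DForm L) :=
  insert (exi (.var 0)) (shift '' Γ)

end DForm

theorem DTerm.shift_subst_single {L : FirstOrder.Language.{u, v}} (s : DTerm L) (t : L.Term ℕ) :
    s.shift.subst (dsingle (.ord t)) = s := by
  cases s with
  | ord s =>
    rw [DTerm.shift, DTerm.rename, dsingle_ord, DTerm.ord_subst_ord]
    exact congrArg _ (tshift_subst_single t s)
  | iota A =>
    rw [DTerm.shift, DTerm.rename, DTerm.iota_subst, DForm.rename_liftRen_succ_subst_single]

namespace DProv

open DForm

variable {L : FirstOrder.Language.{u, v}} {Γ Δ : Set (DForm L)} {A B C F G : DForm L}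
  {r : DTerm L} {s t : L.Term ℕ}

theorem weaken (h : DProv Γ A) (hΔ : Γ ⊆ Δ) : DProv Δ A := by
  induction h generalizing Δ with
  | ax h => exact ax (hΔ h)
  | andI _ _ ih1 ih2 => exact andI (ih1 hΔ) (ih2 hΔ)
  | andE1 _ ih => exact andE1 (ih hΔ)
  | andE2 _ ih => exact andE2 (ih hΔ)
  | impI _ ih => exact impI (ih (Set.insert_subset_insert hΔ))
  | impE _ _ ih1 ih2 => exact impE (ih1 hΔ) (ih2 hΔ)
  | orI1 _ ih => exact orI1 (ih hΔ)
  | orI2 _ ih => exact orI2 (ih hΔ)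
  | orE _ _ _ ih ih1 ih2 =>
    exact orE (ih hΔ) (ih1 (Set.insert_subset_insert hΔ)) (ih2 (Set.insert_subset_insert hΔ))
  | falsumE hA _ ih => exact falsumE hA (ih hΔ)
  | allI _ ih => exact allI (ih (Set.insert_subset_insert (Set.image_mono hΔ)))
  | allE t hA _ _ ih1 ih2 => exact allE t hA (ih1 hΔ) (ih2 hΔ)
  | exI t hA _ _ ih1 ih2 => exact exI t hA (ih1 hΔ) (ih2 hΔ)
  | exE _ _ ih1 ih2 =>
    exact exE (ih1 hΔ)
      (ih2 (Set.insert_subset_insert (Set.insert_subset_insert (Set.image_mono hΔ))))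
  | eqI _ ih => exact eqI (ih hΔ)
  | eqE hA hs ht _ _ ih1 ih2 => exact eqE hA hs ht (ih1 hΔ) (ih2 hΔ)
  | adRel i _ ih => exact adRel i (ih hΔ)
  | adEq1 _ ih => exact adEq1 (ih hΔ)
  | adEq2 _ ih => exact adEq2 (ih hΔ)
  | lambert F => exact lambert F
  | absTerm B t hB => exact absTerm B t hB
  | absIota A B => exact absIota A B

theorem wk (h : DProv Γ A) : DProv (insert B Γ) A :=
  h.weaken (Set.subset_insert B Γ)

theorem hyp : DProv (insert A Γ) A :=
  ax (Set.mem_insert A Γ)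

theorem hyp_under : DProv (underBinder (insert A Γ)) A.shift :=
  ax (Set.mem_insert_of_mem _ ⟨A, Set.mem_insert A Γ, rfl⟩)

theorem cut (h : DProv Γ A) (h' : DProv (insert A Γ) B) : DProv Γ B :=
  impE (impI h') h

theorem iff_intro (h : DProv (insert A Γ) B) (h' : DProv (insert B Γ) A) :
    DProv Γ (DForm.iff A B) :=
  andI (impI h) (impI h')

theorem iff_mp (h : DProv Γ (DForm.iff A B)) (hA : DProv Γ A) : DProv Γ B :=
  impE (andE1 h) hA

theorem iff_mpr (h : DProv Γ (DForm.iff A B)) (hB : DProv Γ B) : DProv Γ A :=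
  impE (andE2 h) hB

theorem eq_trans (h : DProv Γ (eq r (.ord s))) (hst : DProv Γ (eq (.ord s) (.ord t))) :
    DProv Γ (eq r (.ord t)) := by
  have := eqE (A := eq r.shift (.var 0)) (s := .ord s) (t := .ord t)
    trivial trivial trivial hst
  simp only [inst, DForm.subst, DTerm.shift_subst_single] at this
  exact this h

theorem eq_symm (h : DProv Γ (eq (.ord s) (.ord t))) : DProv Γ (eq (.ord t) (.ord s)) := by
  have := eqE (A := eq (.var 0) (DTerm.ord s).shift) (s := .ord s) (t := .ord t)
    trivial trivial trivial h
  simp only [inst, DForm.subst, DTerm.shift_subst_single] at this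
  exact this (eqI (adEq1 h))

theorem iota_eq_iff_all (ht : DProv Γ (exi (.ord t))) :
    DProv Γ (DForm.iff (eq (.iota F) (.ord t))
      (all (DForm.iff F (eq (.var 0) (.ord (tshift t)))))) := by
  have := allE (.ord t) trivial (lambert (F.rename (liftRen Nat.succ))) ht
  simpa only [inst, DForm.iff, DForm.subst, DTerm.iota_subst, rename_liftRen_succ_subst_single,
    DTerm.var, DTerm.subst, dsingle, liftDSub, DTerm.shift, DTerm.rename, tshift] using this

theorem inst_iff_eq_of_iota_eq (h : DProv Γ (eq (.iota F) (.ord t)))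
    (hs : DProv Γ (exi (.ord s))) :
    DProv Γ (DForm.iff (F.inst (.ord s)) (eq (.ord s) (.ord t))) := by
  have := allE (.ord s) trivial ((iota_eq_iff_all (adEq2 h)).iff_mp h) hs
  simp only [inst, DForm.iff, DForm.subst, dsingle_ord, DTerm.ord_subst_ord, DTerm.var,
    tshift_subst_single] at this ⊢
  exact this

theorem inst_of_iota_eq (h : DProv Γ (eq (.iota F) (.ord t))) : DProv Γ (F.inst (.ord t)) :=
  (inst_iff_eq_of_iota_eq h (adEq2 h)).iff_mpr (eqI (adEq2 h))

theorem iota_and_eq_iff (ht : DProv Γ (exi (.ord t))) :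
    DProv Γ (DForm.iff
      (eq (.iota (and B.shift (eq (.var 0) (.ord (tshift t))))) (.ord t)) B) := by
  refine iff_intro ?_ ((iota_eq_iff_all ht.wk).iff_mpr
    (allI (iff_intro (andE2 hyp) (andI hyp_under.wk hyp))))
  have hB := andE1 (A := B.shift.inst (.ord t)) (inst_of_iota_eq
    (F := and B.shift (eq (.var 0) (.ord (tshift t)))) (hyp (Γ := Γ)))
  rwa [shift_inst] at hB

-- The rule `=E` is for atomic formulas only, but by `iota_and_eq_iff` every formula `A(t)` is
-- equivalent to the atomic formula `ι y (A(t) ∧ y = t) = t`.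
theorem inst_of_eq (h : DProv Γ (eq (.ord s) (.ord t))) (hA : DProv Γ (A.inst (.ord s))) :
    DProv Γ (A.inst (.ord t)) := by
  have hE : ∀ r, (eq (.iota (and A.shift (eq (.var 0) (.var 1)))) (.var 0)).inst (.ord r) =
      eq (.iota (and (A.inst (.ord r)).shift (eq (.var 0) (.ord (tshift r))))) (.ord r) := by
    intro r
    simp only [inst, DForm.subst, DTerm.var, DTerm.subst]
    rw [shift_subst_liftDSub_single]
    rfl
  have := eqE (A := eq (.iota (and A.shift (eq (.var 0) (.var 1)))) (.var 0))
    (s := .ord s) (t := .ord t) trivial trivial trivial h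
  rw [hE, hE] at this
  exact (iota_and_eq_iff (adEq2 h)).iff_mp (this ((iota_and_eq_iff (adEq1 h)).iff_mpr hA))

theorem ex_of_delta_iota (h : DProv Γ (delta G (.iota F))) :
    DProv Γ (ex (and (eq (DTerm.iota F).shift (.var 0)) G)) :=
  (absIota F G).iff_mp h

theorem delta_iota_intro (h : DProv Γ (eq (.iota F) (.ord t))) (hG : DProv Γ (G.inst (.ord t))) :
    DProv Γ (delta G (.iota F)) := by
  refine (absIota F G).iff_mpr (exI (.ord t) trivial ?_ (adEq2 h))
  simp only [inst, DForm.subst, DTerm.shift_subst_single]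
  exact andI h hG

theorem delta_iotaI (hF : DProv Γ (F.inst (.ord t))) (hG : DProv Γ (G.inst (.ord t)))
    (ht : DProv Γ (exi (.ord t)))
    (hu : DProv (insert F (underBinder Γ)) (eq (.var 0) (.ord (tshift t)))) :
    DProv Γ (delta G (.iota F)) := by
  refine delta_iota_intro (cut hF ((iota_eq_iff_all ht.wk).iff_mpr
    (allI (iff_intro (hu.weaken ?_) ?_)))) hG
  · exact Set.insert_subset_insert (Set.insert_subset_insert
      (Set.image_mono (Set.subset_insert _ Γ)))
  · have hFt : DProv (insert (eq (.var 0) (.ord (tshift t))) (underBinder (insert _ Γ)))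
        (F.inst (.ord t)).shift := hyp_under.wk
    rw [inst_shift] at hFt
    have hF0 := (eq_symm hyp).inst_of_eq hFt
    rwa [← DTerm.var, rename_liftRen_succ_inst_zero] at hF0

theorem delta_iotaE (h : DProv Γ (delta G (.iota F)))
    (hC : DProv (insert F (insert G (underBinder Γ))) C.shift) : DProv Γ C := by
  refine exE (ex_of_delta_iota h) (cut (A := G) (andE2 hyp) (cut (A := F) (wk ?_) (hC.weaken ?_)))
  · have hF := inst_of_iota_eq (F := F.rename (liftRen Nat.succ)) (t := .var 0)
      (andE1 (B := G) (hyp (Γ := underBinder Γ)))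
    rwa [← DTerm.var, rename_liftRen_succ_inst_zero] at hF
  · exact Set.insert_subset_insert (Set.insert_subset_insert (Set.subset_insert _ _))

theorem iota_eq_of_delta_iota (h : DProv Γ (delta G (.iota F))) (ht : DProv Γ (exi (.ord t)))
    (hF : DProv Γ (F.inst (.ord t))) : DProv Γ (eq (.iota F) (.ord t)) := by
  refine cut (andI ht hF) (exE (ex_of_delta_iota h.wk)
    ((andE1 hyp).eq_trans (t := tshift t) (eq_symm ?_)))
  have ht' : DProv (insert (and (eq (DTerm.iota F).shift (.var 0)) G) (underBinder (insert _ Γ)))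
      (and (exi (.ord t)) (F.inst (.ord t))).shift := hyp_under.wk
  exact (inst_iff_eq_of_iota_eq (andE1 hyp) (andE1 ht')).iff_mp (inst_shift F t ▸ andE2 ht')

theorem eq_of_delta_iota (h : DProv Γ (delta G (.iota F)))
    (hs : DProv Γ (exi (.ord s))) (ht : DProv Γ (exi (.ord t)))
    (hFs : DProv Γ (F.inst (.ord s))) (hFt : DProv Γ (F.inst (.ord t))) :
    DProv Γ (eq (.ord s) (.ord t)) :=
  (inst_iff_eq_of_iota_eq (iota_eq_of_delta_iota h ht hFt) hs).iff_mp hFs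

end DProv

theorem IProv.upsilon {L : FirstOrder.Language.{u, v}} {Γ : Set (IForm L)} {A : IForm L}
    (h : IProv Γ A) : DProv (upsilon '' Γ) (upsilon A) := by
  induction h with
  | ax h => exact .ax ⟨_, h, rfl⟩
  | andI _ _ ih1 ih2 => exact .andI ih1 ih2
  | andE1 _ ih => exact .andE1 ih
  | andE2 _ ih => exact .andE2 ih
  | impI _ ih =>
    rw [Set.image_insert_eq] at ih
    exact .impI ih
  | impE _ _ ih1 ih2 => exact .impE ih1 ih2
  | orI1 _ ih => exact .orI1 ih
  | orI2 _ ih => exact .orI2 ih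
  | orE _ _ _ ih ih1 ih2 =>
    rw [Set.image_insert_eq] at ih1 ih2
    exact .orE ih ih1 ih2
  | falsumE hA _ ih => exact .falsumE hA.upsilon ih
  | allI _ ih =>
    rw [Set.image_insert_eq, upsilon_image_shift] at ih
    exact .allI ih
  | allE t _ _ ih1 ih2 => exact upsilon_inst .. ▸ .allE (.ord t) trivial ih1 ih2
  | exI t _ _ ih1 ih2 => exact .exI (.ord t) trivial (upsilon_inst .. ▸ ih1) ih2
  | exE _ _ ih1 ih2 =>
    rw [Set.image_insert_eq, Set.image_insert_eq, upsilon_image_shift, upsilon_shift] at ih2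
    exact .exE ih1 ih2
  | eqI _ ih => exact .eqI ih
  | eqE _ _ _ ih1 ih2 => exact upsilon_inst .. ▸ ih1.inst_of_eq (upsilon_inst .. ▸ ih2)
  | adRel i _ ih => exact .adRel i ih
  | adEq1 _ ih => exact .adEq1 ih
  | adEq2 _ ih => exact .adEq2 ih
  | iotaI t _ _ _ _ ih1 ih2 ih3 ih4 =>
    rw [upsilon_inst] at ih1 ih2
    rw [Set.image_insert_eq, Set.image_insert_eq, upsilon_image_shift] at ih4
    exact .delta_iotaI ih1 ih2 ih3 ih4
  | iotaE1 _ _ ih1 ih2 =>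
    rw [Set.image_insert_eq, Set.image_insert_eq, Set.image_insert_eq, upsilon_image_shift,
      upsilon_shift] at ih2
    exact .delta_iotaE ih1 ih2
  | iotaE2 _ _ _ _ _ ih1 ih2 ih3 ih4 ih5 =>
    rw [upsilon_inst] at ih4 ih5
    exact .eq_of_delta_iota ih1 ih2 ih3 ih4 ih5

end FreeLogic

theorem theorem2 (L : FirstOrder.Language.{u, v}) :
    (∀ (Γ : Set (FreeLogic.IForm L)) (A : FreeLogic.IForm L),
      FreeLogic.IProv Γ A →
        FreeLogic.DProv (FreeLogic.upsilon '' Γ) (FreeLogic.upsilon A)) ∧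
    (∀ (Γ : Set (FreeLogic.DForm L)) (A : FreeLogic.DForm L),
      FreeLogic.DProv Γ A →
        FreeLogic.IProv (FreeLogic.tau '' Γ) (FreeLogic.tau A)) := by
  exact ⟨fun _ _ h => h.upsilon, fun _ _ h => h.tau⟩
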